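/- Let $\alpha$ be a regular cardinal and let $\mathcal A$ be a Grothendieck abelian category that is locally $\alpha$-presentable. For a regular cardinal $\beta$ let $\mathcal A^\beta$ denote the full subcategory of $\beta$-presentable objects, i.e. of objects $X$ such that $\operatorname{Hom}_{\mathcal A}(X,-)$ preserves $\beta$-filtered colimits. Suppose that the (essentially small) category $\mathcal C:=\mathcal A^\alpha$ is abelian. Let $\operatorname{Mod}\mathcal C$ be the abelian category of additive functors $\mathcal C^{\mathrm{op}}\to\mathsf{Ab}$, and let $\operatorname{mod}_\alpha\mathcal C:=(\operatorname{Mod}\mathcal C)^\alpha$ be its full subcategory of $\alpha$-presentable objects. Let $\operatorname{eff}_\alpha\mathcal C\subseteq\operatorname{mod}_\alpha\mathcal C$ be the full subcategory of objects annihilated by the left adjoint of the Yoneda functor $\mathcal C\to\operatorname{mod}_\alpha\mathcal C$, $X\mapsto\operatorname{Hom}_{\mathcal C}(-,X)$. Let $\operatorname{Eff}_\alpha\mathcal C=\operatorname{Ind}_\alpha\operatorname{eff}_\alpha\mathcal C$, viewed as the full subcategory of $\operatorname{Mod}\mathcal C$ consisting of the colimits of small $\alpha$-filtered diagrams of objects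 of $\operatorname{eff}_\alpha\mathcal C$. Then: 1. The functor $\mathcal A\to\operatorname{Mod}\mathcal A^\alpha$, $X\mapsto\operatorname{Hom}_{\mathcal A}(-,X)|_{\mathcal A^\alpha}$, has an exact left adjoint $Q\colon\operatorname{Mod}\mathcal A^\alpha\to\mathcal A$. The subcategory $\operatorname{Eff}_\alpha\mathcal A^\alpha$ is a Serre subcategory of $\operatorname{Mod}\mathcal A^\alpha$ and consists precisely of the objects annihilated by $Q$, and $Q$ induces an equivalence $$\frac{\operatorname{Mod}\mathcal A^\alpha}{\operatorname{Eff}_\alpha\mathcal A^\alpha}\xrightarrow{\ \sim\ }\mathcal A ,$$ where the quotient is the localisation of $\operatorname{Mod}\mathcal A^\alpha$ at the morphisms whose kernel and cokernel belong to $\operatorname{Eff}_\alpha\mathcal A^\alpha$. 2. The category $\mathcal A^\beta$ is abelian for every regular cardinal $\beta\ge\alpha$. -/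

import Mathlib

open CategoryTheory Limits Opposite

universe v u

noncomputable section

section ModuleCategory

variable {C : Type u} [Category.{v} C] [Preadditive C]

/-- The category `Mod C` of `C`-modules: additive functors from `Cᵒᵖ` to abelian groups. -/
abbrev ModCat (C : Type u) [Category.{v} C] [Preadditive C] :=
  Cᵒᵖ ⥤+ AddCommGrpCat.{v}

theorem additiveFunctor_of_isColimit {J : Type*} [Category* J]
    {F : J ⥤ Cᵒᵖ ⥤ AddCommGrpCat.{v}}
    (hF : ∀ j, (F.obj j).Additive) {c : Cocone F} (hc : ∀ X, IsColimit
      (((evaluation _ _).obj X).mapCocone c)) : c.pt.Additive where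
  map_add {X Y f g} := by
    refine (hc X).hom_ext fun j => ?_
    have := hF j
    have h : ∀ a : X ⟶ Y, (c.ι.app j).app X ≫ c.pt.map a =
      (F.obj j).map a ≫ (c.ι.app j).app Y := fun a => ((c.ι.app j).naturality a).symm
    change (c.ι.app j).app X ≫ _ = (c.ι.app j).app X ≫ _
    rw [Preadditive.comp_add, h, h, h, Functor.map_add, Preadditive.add_comp]

theorem additiveFunctor_of_isLimit {J : Type*} [Category* J]
    {F : J ⥤ Cᵒᵖ ⥤ AddCommGrpCat.{v}}
    (hF : ∀ j, (F.obj j).Additive) {c : Cone F} (hc : ∀ X, IsLimit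
      (((evaluation _ _).obj X).mapCone c)) : c.pt.Additive where
  map_add {X Y f g} := by
    refine (hc Y).hom_ext fun j => ?_
    have := hF j
    have h : ∀ a : X ⟶ Y, c.pt.map a ≫ (c.π.app j).app Y =
      (c.π.app j).app X ≫ (F.obj j).map a := fun a => (c.π.app j).naturality a
    change _ ≫ (c.π.app j).app Y = _ ≫ (c.π.app j).app Y
    rw [Preadditive.add_comp, h, h, h, Functor.map_add, Preadditive.comp_add]

instance isClosedUnderColimits_additiveFunctor (J : Type*) [Category* J]
    [HasColimitsOfShape J AddCommGrpCat.{v}] :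
    (additiveFunctor Cᵒᵖ AddCommGrpCat.{v}).IsClosedUnderColimitsOfShape J where
  colimitsOfShape_le := by
    rintro _ ⟨h⟩
    exact additiveFunctor_of_isColimit (c := h.cocone) h.prop_diag_obj
      fun X => isColimitOfPreserves ((evaluation _ _).obj X) h.isColimit

instance isClosedUnderLimits_additiveFunctor (J : Type*) [Category* J]
    [HasLimitsOfShape J AddCommGrpCat.{v}] :
    (additiveFunctor Cᵒᵖ AddCommGrpCat.{v}).IsClosedUnderLimitsOfShape J where
  limitsOfShape_le := by
    rintro _ ⟨h⟩
    exact additiveFunctor_of_isLimit (c := h.cone) h.prop_diag_obj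
      fun X => isLimitOfPreserves ((evaluation _ _).obj X) h.isLimit

instance : (additiveFunctor Cᵒᵖ AddCommGrpCat.{v}).IsClosedUnderKernels where
  kernels_le := by
    rintro _ ⟨f, k, hk, hf⟩
    refine additiveFunctor_of_isLimit (c := k) ?_
      fun X => isLimitOfPreserves ((evaluation _ _).obj X) hk
    rintro (_ | _)
    exacts [hf.1, hf.2]

instance : (additiveFunctor Cᵒᵖ AddCommGrpCat.{v}).IsClosedUnderCokernels where
  cokernels_le := by
    rintro _ ⟨f, k, hk, hf⟩
    refine additiveFunctor_of_isColimit (c := k) ?_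
      fun X => isColimitOfPreserves ((evaluation _ _).obj X) hk
    rintro (_ | _)
    exacts [hf.1, hf.2]

instance : (additiveFunctor Cᵒᵖ AddCommGrpCat.{v}).IsClosedUnderFiniteProducts where

instance : (additiveFunctor Cᵒᵖ AddCommGrpCat.{v}).ContainsZero where
  exists_zero := by
    have h := isZero_zero (Cᵒᵖ ⥤ AddCommGrpCat.{v})
    exact ⟨_, h, ⟨by intros; exact (h.obj _).eq_of_src _ _⟩⟩

/-- `Mod C` is abelian, with pointwise kernels and cokernels. -/
instance : Abelian (ModCat C) := inferInstance

/-- The Yoneda functor `C ⥤ Mod C`, `X ↦ Hom(-, X)`. -/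
def yonedaMod (C : Type u) [Category.{v} C] [Preadditive C] : C ⥤ ModCat C :=
  (additiveFunctor Cᵒᵖ AddCommGrpCat.{v}).lift preadditiveYoneda
    fun X => additive_yonedaObj' X

/-- The Yoneda lemma: `Hom(Hom(-, X), F)` is, naturally in `F`, the set `F X`. -/
def coyonedaYonedaModIso (X : C) :
    coyoneda.obj (op ((yonedaMod C).obj X)) ≅
      ((AdditiveFunctor.forget Cᵒᵖ AddCommGrpCat.{v} ⋙ (evaluation _ _).obj (op X)) ⋙
        forget AddCommGrpCat.{v}) ⋙ uliftFunctor.{max u v} :=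
  NatIso.ofComponents (fun F => Equiv.toIso
    { toFun := fun f => ULift.up ((f.hom.app (op X)).hom (𝟙 X))
      invFun := fun x => ObjectProperty.homMk
        { app := fun Y => AddCommGrpCat.ofHom (AddMonoidHom.mk'
            (fun g : Y.unop ⟶ X => (F.obj.map g.op).hom x.down)
            (fun g h => by
              have e : (g + h).op = g.op + h.op := rfl
              rw [e, Functor.map_add]; rfl))
          naturality := by
            intro Y Z k
            ext (g : Y.unop ⟶ X)
            change (F.obj.map (k.unop ≫ g).op).hom x.down =
              (F.obj.map k).hom ((F.obj.map g.op).hom x.down)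
            rw [op_comp, Functor.map_comp]; rfl }
      left_inv := by
        intro f
        refine ObjectProperty.hom_ext _ ?_
        ext Y (g : Y.unop ⟶ X)
        have h := congr($(f.hom.naturality g.op).hom (𝟙 X))
        change (f.hom.app Y).hom (g ≫ 𝟙 X) =
          (F.obj.map g.op).hom ((f.hom.app (op X)).hom (𝟙 X)) at h
        rw [Category.comp_id] at h
        exact h.symm
      right_inv := by
        rintro ⟨x⟩
        change ULift.up ((F.obj.map (𝟙 (op X))).hom x) = ULift.up x
        rw [F.obj.map_id]; rfl }) (fun _ => rfl)

/-- Representable modules are `κ`-presentable. -/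
theorem isCardinalPresentable_yonedaMod (κ : Cardinal.{v}) [Fact κ.IsRegular] (X : C) :
    isCardinalPresentable (ModCat C) κ ((yonedaMod C).obj X) where
  preservesColimitOfShape J _ _ := by
    have := isFiltered_of_isCardinalFiltered J κ
    exact preservesColimitsOfShape_of_natIso (coyonedaYonedaModIso X).symm

variable (C) (κ : Cardinal.{v}) [Fact κ.IsRegular]

/-- The category `mod_κ C` of `κ`-presentable `C`-modules. -/
abbrev modPresentable := (isCardinalPresentable (ModCat C) κ).FullSubcategory

/-- The Yoneda functor `C ⥤ mod_κ C`. -/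
def yonedaModPresentable : C ⥤ modPresentable C κ :=
  (isCardinalPresentable (ModCat C) κ).lift (yonedaMod C) (isCardinalPresentable_yonedaMod κ)

/-- `eff_κ C`: the `κ`-presentable modules that are annihilated by the left adjoint of the
Yoneda functor `C ⥤ mod_κ C` (this left adjoint exists when `C` has `κ`-small colimits). -/
def effCard : ObjectProperty (ModCat C) := fun F =>
  ∃ (hF : isCardinalPresentable (ModCat C) κ F) (L : modPresentable C κ ⥤ C)
    (_ : L ⊣ yonedaModPresentable C κ), IsZero (L.obj ⟨F, hF⟩)

/-- `Eff_κ C = Ind_κ (eff_κ C)`, as a full subcategory of `Mod C`: the modules that are colimits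
in `Mod C` of small `κ`-filtered diagrams of objects of `eff_κ C`. -/
def EffCard : ObjectProperty (ModCat C) := fun F =>
  ∃ (J : Type v) (_ : SmallCategory J), IsCardinalFiltered J κ ∧
    (effCard C κ).colimitsOfShape J F

end ModuleCategory

section Presentable

variable (A : Type u) [Category.{v} A]

/-- The full subcategory `A^κ` of `κ`-presentable objects. -/
abbrev presentableObjects (κ : Cardinal.{v}) [Fact κ.IsRegular] :=
  (isCardinalPresentable A κ).FullSubcategory

/-- The restricted Yoneda functor `A ⥤ Mod A^κ`, `X ↦ Hom_A(-, X)|_{A^κ}`. -/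
def restrictedYoneda [Preadditive A] (κ : Cardinal.{v}) [Fact κ.IsRegular] :
    A ⥤ ModCat (presentableObjects A κ) :=
  (additiveFunctor (presentableObjects A κ)ᵒᵖ AddCommGrpCat.{v}).lift
    (preadditiveYoneda ⋙ (Functor.whiskeringLeft _ _ _).obj (isCardinalPresentable A κ).ι.op)
    fun X => inferInstanceAs
      (((isCardinalPresentable A κ).ι.op ⋙ preadditiveYoneda.obj X).Additive)

end Presentable

/-- A category is abelian if it admits the structure of an abelian category (the group structure
on morphisms being then uniquely determined). -/
def IsAbelianCategory (C : Type u) [Category.{v} C] : Prop := Nonempty (Abelian C)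

end

/-! Write `R` for the restricted Yoneda functor. It is fully faithful because the `κ`-presentable
objects are dense, and it has a left adjoint `Q` with `Q(Hom(-, X)) ≅ X`. Once `Q` is known to be
exact, it is the localisation at the Serre subcategory of objects it kills.

Exactness is a Gabriel–Popescu argument. The key is `Adjunction.mono_homEquiv_symm`: the transpose
`Q K ⟶ B` of a monomorphism `K ⟶ R B` is a monomorphism. Exactness of filtered colimits in `A`
reduces this to finite sums of representables, where morphisms lift along `Q`. Covering a module by
a coproduct of representables then shows that `Q` preserves all monomorphisms.

The kernel of `Q` is `EffCard` by a cofinality argument: if `Q F = 0`, every map from a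
`κ`-presentable module to `F` factors through a `κ`-presentable module killed by `Q`
(`Adjunction.exists_factors_of_isZero`).

For the second claim, kernels in `A^κ` are kernels in `A`, so `A^κ` is closed under kernels. This
passes to `β ≥ κ` through coherence: a `β`-presentable object is covered by a `β`-small coproduct of
`κ`-presentable ones, and the kernel of a map from such a coproduct is covered by the kernels on its
finite subcoproducts, of which there are fewer than `β`. -/

namespace CategoryTheory

/-! ### Filtered colimits of cokernels and stages that are already epimorphic. -/

section FilteredCokernels

universe w v' u'

variable {A : Type u} [Category.{v} A] [Abelian A] {J : Type u'} [Category.{v'} J]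

/-- For a morphism `g` from the colimit of `F`, the functor `j ↦ coker (F j ⟶ X)`. -/
noncomputable def cokernelDiagram {F : J ⥤ A} (c : Cocone F) {X : A} (g : c.pt ⟶ X) : J ⥤ A where
  obj j := cokernel (c.ι.app j ≫ g)
  map {i j} f := cokernel.desc _ (cokernel.π _) (by
    rw [← c.w f, Category.assoc, Category.assoc, ← Category.assoc (c.ι.app j),
      cokernel.condition, comp_zero])

/-- The projection of `X` to the cokernel of `F j ⟶ X`. -/
noncomputable def cokernelDiagramπ {F : J ⥤ A} (c : Cocone F) {X : A} (g : c.pt ⟶ X) (j : J) :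
    X ⟶ (cokernelDiagram c g).obj j :=
  cokernel.π (c.ι.app j ≫ g)

instance {F : J ⥤ A} (c : Cocone F) {X : A} (g : c.pt ⟶ X) (j : J) :
    Epi (cokernelDiagramπ c g j) :=
  inferInstanceAs (Epi (cokernel.π _))

theorem cokernelDiagramπ_map {F : J ⥤ A} (c : Cocone F) {X : A} (g : c.pt ⟶ X) {i j : J}
    (f : i ⟶ j) :
    cokernelDiagramπ c g i ≫ (cokernelDiagram c g).map f = cokernelDiagramπ c g j :=
  cokernel.π_desc _ _ _

theorem cokernelDiagramπ_map_assoc {F : J ⥤ A} (c : Cocone F) {X : A} (g : c.pt ⟶ X) {i j : J}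
    (f : i ⟶ j) {Z : A} (h : (cokernelDiagram c g).obj j ⟶ Z) :
    cokernelDiagramπ c g i ≫ (cokernelDiagram c g).map f ≫ h = cokernelDiagramπ c g j ≫ h :=
  cokernel.π_desc_assoc _ _ _ _

theorem ι_app_comp_cokernelDiagramπ {F : J ⥤ A} (c : Cocone F) {X : A} (g : c.pt ⟶ X) (j : J) :
    c.ι.app j ≫ g ≫ cokernelDiagramπ c g j = 0 :=
  (Category.assoc _ _ _).symm.trans (cokernel.condition (c.ι.app j ≫ g))

theorem ι_app_comp_cokernelDiagramπ_assoc {F : J ⥤ A} (c : Cocone F) {X : A} (g : c.pt ⟶ X)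
    (j : J) {Z : A} (h : (cokernelDiagram c g).obj j ⟶ Z) :
    c.ι.app j ≫ g ≫ cokernelDiagramπ c g j ≫ h = 0 ≫ h := by
  rw [← ι_app_comp_cokernelDiagramπ c g j, Category.assoc, Category.assoc]

theorem exact_cokernelDiagramπ {F : J ⥤ A} (c : Cocone F) {X : A} (g : c.pt ⟶ X) (j : J) :
    (ShortComplex.mk (c.ι.app j ≫ g) (cokernelDiagramπ c g j)
      (cokernel.condition (c.ι.app j ≫ g))).Exact :=
  ShortComplex.exact_cokernel (c.ι.app j ≫ g)

/-- The cocone with point `coker g` over `j ↦ coker (F j ⟶ X)`. -/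
noncomputable def cokernelDiagramCocone {F : J ⥤ A} (c : Cocone F) {X : A} (g : c.pt ⟶ X) :
    Cocone (cokernelDiagram c g) where
  pt := cokernel g
  ι :=
    { app j := cokernel.desc (c.ι.app j ≫ g) (cokernel.π g) (by simp)
      naturality i j f := by
        refine (cancel_epi (cokernelDiagramπ c g i)).1 ?_
        refine (cokernelDiagramπ_map_assoc c g f _).trans ?_
        exact (cokernel.π_desc _ _ _).trans ((cokernel.π_desc_assoc _ _ _ _).trans
          (Category.comp_id _)).symm }

theorem cokernelDiagramπ_cocone {F : J ⥤ A} (c : Cocone F) {X : A} (g : c.pt ⟶ X) (j : J) :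
    cokernelDiagramπ c g j ≫ (cokernelDiagramCocone c g).ι.app j = cokernel.π g :=
  cokernel.π_desc _ _ _

theorem cokernelDiagramπ_ι_app_eq [IsConnected J] {F : J ⥤ A} {c : Cocone F} {X : A}
    {g : c.pt ⟶ X} (s : Cocone (cokernelDiagram c g)) (i j : J) :
    cokernelDiagramπ c g i ≫ s.ι.app i = cokernelDiagramπ c g j ≫ s.ι.app j :=
  constant_of_preserves_morphisms
    (fun j => (cokernelDiagramπ c g j ≫ s.ι.app j : X ⟶ s.pt))
    (fun i j f => by rw [← s.w f, cokernelDiagramπ_map_assoc]) i j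

/-- Filtered colimits commute with cokernels of morphisms to a fixed object. -/
noncomputable def isColimitCokernelDiagramCocone [IsConnected J] {F : J ⥤ A} {c : Cocone F}
    (hc : IsColimit c) {X : A} (g : c.pt ⟶ X) : IsColimit (cokernelDiagramCocone c g) where
  desc s := cokernel.desc g
    (cokernelDiagramπ c g (Classical.arbitrary J) ≫ s.ι.app (Classical.arbitrary J)) (by
      refine hc.hom_ext fun j => ?_
      rw [cokernelDiagramπ_ι_app_eq s _ j, comp_zero]
      exact (ι_app_comp_cokernelDiagramπ_assoc c g j _).trans zero_comp)
  fac s j := by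
    refine (cancel_epi (cokernelDiagramπ c g j)).1 ?_
    refine (Category.assoc _ _ _).symm.trans ?_
    refine (congrArg (· ≫ _) (cokernelDiagramπ_cocone c g j)).trans ?_
    exact (cokernel.π_desc _ _ _).trans (cokernelDiagramπ_ι_app_eq s _ j)
  uniq s m hm := by
    refine (cancel_epi (cokernel.π g)).1 ?_
    refine Eq.trans ?_ (cokernel.π_desc _ _ _).symm
    rw [← hm, ← Category.assoc, cokernelDiagramπ_cocone]
    rfl

variable (κ : Cardinal.{w}) [Fact κ.IsRegular] [EssentiallySmall.{w} J] [IsCardinalFiltered J κ]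

/-- If a `κ`-filtered colimit maps epimorphically onto a `κ`-presentable object, so does
some member of the diagram. -/
theorem exists_epi_of_isColimit {F : J ⥤ A} {c : Cocone F} (hc : IsColimit c) {X : A}
    [IsCardinalPresentable X κ] (g : c.pt ⟶ X) [Epi g] :
    ∃ j, Epi (c.ι.app j ≫ g : F.obj j ⟶ X) := by
  have := isFiltered_of_isCardinalFiltered J κ
  have := IsFiltered.isConnected J
  -- The cokernels of `F j ⟶ X` have colimit `coker g = 0`, so the projection from the presentable
  -- `X` already vanishes at some stage.
  obtain ⟨j, u, hu⟩ := IsCardinalPresentable.exists_eq_of_isColimit' κ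
    (isColimitCokernelDiagramCocone hc g) (cokernelDiagramπ c g (Classical.arbitrary J)) 0
    ((isZero_cokernel_of_epi g).eq_of_tgt _ _)
  rw [cokernelDiagramπ_map, zero_comp] at hu
  exact ⟨j, Preadditive.epi_of_cokernel_zero hu⟩

/-- If `K` is the kernel of an epimorphism between `κ`-presentable objects and `K` is a
`κ`-filtered colimit, then some member of the diagram maps epimorphically onto `K`. -/
theorem exists_epi_of_isColimit_of_exact {F : J ⥤ A} {c : Cocone F} (hc : IsColimit c) {P X : A}
    [IsCardinalPresentable P κ] [IsCardinalPresentable X κ] (k : c.pt ⟶ P) (q : P ⟶ X)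
    [Mono k] [Epi q] (w : k ≫ q = 0) (h : (ShortComplex.mk k q w).Exact) :
    ∃ j, Epi (c.ι.app j : F.obj j ⟶ c.pt) := by
  have := isFiltered_of_isCardinalFiltered J κ
  have := IsFiltered.isConnected J
  obtain ⟨d, hd⟩ : ∃ d : X ⟶ cokernel k, q ≫ d = cokernel.π k :=
    ⟨h.desc (cokernel.π k) (cokernel.condition k), h.g_desc _ _⟩
  -- Presentability of `X` lifts `d` to a stage `i`. Presentability of `P` then makes `q ≫ s` agree
  -- with the projection at a later stage `j`, so `k` dies in `coker (F j ⟶ P)`: the image of `F j`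
  -- is all of `c.pt`.
  obtain ⟨i, s, hs⟩ := IsCardinalPresentable.exists_hom_of_isColimit κ
    (isColimitCokernelDiagramCocone hc k) d
  obtain ⟨j, u, hu⟩ := IsCardinalPresentable.exists_eq_of_isColimit' κ
    (isColimitCokernelDiagramCocone hc k) (i := i) (q ≫ s) (cokernelDiagramπ c k i) (by
      rw [Category.assoc, hs, cokernelDiagramπ_cocone]
      exact hd)
  have hz : k ≫ cokernelDiagramπ c k j = 0 := by
    rw [cokernelDiagramπ_map] at hu
    rw [← hu, Category.assoc, reassoc_of% w, zero_comp]
  refine ⟨j, (epi_iff_surjective_up_to_refinements _).2 fun B y => ?_⟩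
  obtain ⟨B', π, hπ, x, hx⟩ := (exact_cokernelDiagramπ c k j).exact_up_to_refinements (y ≫ k)
    ((Category.assoc _ _ _).trans ((congrArg (y ≫ ·) hz).trans comp_zero))
  refine ⟨B', π, hπ, x, (cancel_mono k).1 ?_⟩
  exact (Category.assoc _ _ _).trans (hx.trans (Category.assoc _ _ _).symm)

end FilteredCokernels

/-! ### Coproducts as `κ`-filtered colimits of `κ`-small subcoproducts. -/

section Subcoproducts

open CardinalDirectedPoset


universe w

variable {A : Type u} [Category.{v} A] (κ : Cardinal.{w}) {J : Type w} (f : J → A)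
  [HasCoproducts.{w} A]

/-- The diagram of the coproducts of the `κ`-small subfamilies of `f`. -/
noncomputable def subcoproductsDiagram : SetCardinalLT κ J ⥤ A where
  obj S := ∐ fun x : S.1 => f x.1
  map {S T} h := Limits.Sigma.desc fun x : S.1 => Limits.Sigma.ι (fun x : T.1 => f x.1) ⟨x.1, leOfHom h x.2⟩

/-- The inclusion of the coproduct of a `κ`-small subfamily. -/
noncomputable def subcoproductsι (S : SetCardinalLT κ J) : (∐ fun x : S.1 => f x.1) ⟶ ∐ f :=
  Limits.Sigma.desc fun x => Limits.Sigma.ι f x.1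

theorem ι_subcoproductsι (S : SetCardinalLT κ J) (x : S.1) :
    Limits.Sigma.ι (fun x : S.1 => f x.1) x ≫ subcoproductsι κ f S = Limits.Sigma.ι f x.1 :=
  Limits.Sigma.ι_desc _ _

theorem ι_subcoproductsι_assoc (S : SetCardinalLT κ J) (x : S.1) {Z : A} (h : ∐ f ⟶ Z) :
    Limits.Sigma.ι (fun x : S.1 => f x.1) x ≫ subcoproductsι κ f S ≫ h =
      Limits.Sigma.ι f x.1 ≫ h :=
  Limits.Sigma.ι_desc_assoc _ _ _

variable [Fact κ.IsRegular]

/-- The coproduct of `f` as a cocone over the coproducts of the `κ`-small subfamilies. -/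
noncomputable def subcoproductsCocone : Cocone (subcoproductsDiagram κ f) where
  pt := ∐ f
  ι :=
    { app S := subcoproductsι κ f S
      naturality S T h := by
        refine (Limits.Sigma.hom_ext _ _ fun x => ?_).trans (Category.comp_id _).symm
        refine (Limits.Sigma.ι_desc_assoc ..).trans ?_
        exact (ι_subcoproductsι ..).trans (ι_subcoproductsι κ f S x).symm }

/-- A coproduct is the `κ`-filtered colimit of the coproducts of its `κ`-small subfamilies. -/
noncomputable def isColimitSubcoproductsCocone : IsColimit (subcoproductsCocone κ f) where
  desc s := Limits.Sigma.desc fun j =>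
    Limits.Sigma.ι (fun x : (SetCardinalLT.singleton κ j).1 => f x.1) ⟨j, rfl⟩ ≫
      s.ι.app (SetCardinalLT.singleton κ j)
  fac s S := by
    refine Limits.Sigma.hom_ext _ _ fun x => ?_
    let i : SetCardinalLT.singleton κ x.1 ⟶ S := homOfLE (by
      rintro _ rfl
      exact x.2)
    refine (Limits.Sigma.ι_desc_assoc ..).trans ?_
    refine (Limits.Sigma.ι_desc ..).trans ?_
    refine (congrArg (_ ≫ ·) (s.w i).symm).trans ?_
    exact (Limits.Sigma.ι_desc_assoc ..)
  uniq s m hm := by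
    refine Limits.Sigma.hom_ext _ _ fun j => ?_
    refine Eq.trans ?_ (Limits.Sigma.ι_desc ..).symm
    refine Eq.trans ?_ (congrArg (_ ≫ ·) (hm _))
    exact (ι_subcoproductsι_assoc κ f (SetCardinalLT.singleton κ j) ⟨j, rfl⟩ _).symm

/-- The inclusion of a subcoproduct is a monomorphism. -/
instance mono_subcoproductsι [HasZeroMorphisms A] (S : SetCardinalLT κ J) :
    Mono (subcoproductsι κ f S) := by
  classical
  have : subcoproductsι κ f S ≫ Limits.Sigma.desc (fun j =>
      if h : j ∈ S.1 then Limits.Sigma.ι (fun x : S.1 => f x.1) ⟨j, h⟩ else 0) = 𝟙 _ := by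
    refine Limits.Sigma.hom_ext _ _ fun x => ?_
    simp [subcoproductsι]
  exact mono_of_mono_fac this

/-- A morphism from a `κ`-presentable object to a coproduct factors through the coproduct of a
`κ`-small subfamily. -/
theorem exists_comp_subcoproductsι_eq {X : A} [IsCardinalPresentable X κ] (g : X ⟶ ∐ f) :
    ∃ (S : SetCardinalLT κ J) (g' : X ⟶ ∐ fun x : S.1 => f x.1), g' ≫ subcoproductsι κ f S = g :=
  IsCardinalPresentable.exists_hom_of_isColimit κ (isColimitSubcoproductsCocone κ f) g

end Subcoproducts

/-! ### Presentable, generated and coherent objects. -/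

section FiniteColimits

universe w

variable {A : Type u} [Category.{v} A] [LocallySmall.{w} A] {β : Cardinal.{w}} [Fact β.IsRegular]

theorem isClosedUnderFiniteColimits_isCardinalPresentable {J : Type} [SmallCategory J] [FinCategory J] :
    (isCardinalPresentable A β).IsClosedUnderColimitsOfShape J :=
  isClosedUnderColimitsOfShape_isCardinalPresentable A (κ := β)
    (hasCardinalLT_of_finite _ _ (Cardinal.IsRegular.aleph0_le Fact.out))

instance isClosedUnderCokernels_isCardinalPresentable [Abelian A] :
    (isCardinalPresentable A β).IsClosedUnderCokernels where
  cokernels_le := by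
    rintro _ ⟨f, k, hk, hf⟩
    have := isClosedUnderFiniteColimits_isCardinalPresentable (A := A) (β := β)
      (J := WalkingParallelPair)
    refine (isCardinalPresentable A β).prop_of_isColimit hk ?_
    rintro (_ | _)
    exacts [hf.1, hf.2]

end FiniteColimits

section Coherence

variable {A : Type u} [Category.{v} A]

theorem isCardinalPresentable_sigma [LocallySmall.{v} A] {β : Cardinal.{v}} [Fact β.IsRegular]
    {I : Type v} (hI : HasCardinalLT I β) (X : I → A) [HasCoproduct X]
    (hX : ∀ i, IsCardinalPresentable (X i) β) : IsCardinalPresentable (∐ X) β := by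
  have : (isCardinalPresentable A β).IsClosedUnderColimitsOfShape (Discrete I) :=
    isClosedUnderColimitsOfShape_isCardinalPresentable A
      ((hasCardinalLT_arrow_discrete_iff β).2 hI)
  exact (isCardinalPresentable A β).prop_colimit _ fun i => hX i.as

/-- An object is `β`-generated if it is a quotient of a `β`-presentable object. -/
def isCardinalGenerated (A : Type u) [Category.{v} A] (β : Cardinal.{v}) [Fact β.IsRegular] :
    ObjectProperty A := fun X =>
  ∃ (N : A) (p : N ⟶ X), IsCardinalPresentable N β ∧ Epi p

theorem isCardinalGenerated_of_epi {β : Cardinal.{v}} [Fact β.IsRegular] {X Y : A} (p : X ⟶ Y)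
    [Epi p] (hX : isCardinalGenerated A β X) : isCardinalGenerated A β Y := by
  obtain ⟨N, q, hN, hq⟩ := hX
  exact ⟨N, q ≫ p, hN, inferInstance⟩

/-- An object `Y` is `β`-coherent if the kernels of all morphisms from `β`-presentable objects
to `Y` are `β`-generated. -/
def isCardinalCoherent (A : Type u) [Category.{v} A] [Abelian A] (β : Cardinal.{v})
    [Fact β.IsRegular] : ObjectProperty A := fun Y =>
  ∀ ⦃N : A⦄ (f : N ⟶ Y), IsCardinalPresentable N β → isCardinalGenerated A β (kernel f)

variable [Abelian A] {β : Cardinal.{v}} [Fact β.IsRegular]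

/-- Lifting along `e` shows that `ker (e ≫ f)` surjects onto `ker f`. Coherence may therefore be
tested after replacing the source by a cover. -/
theorem isCardinalGenerated_kernel_of_epi_comp {N' N Y : A} (e : N' ⟶ N) [Epi e] (f : N ⟶ Y)
    (h : isCardinalGenerated A β (kernel (e ≫ f))) : isCardinalGenerated A β (kernel f) := by
  let m : kernel (e ≫ f) ⟶ kernel f := kernel.lift f (kernel.ι _ ≫ e) (by simp)
  have : Epi m := by
    refine (epi_iff_surjective_up_to_refinements m).2 fun B y => ?_
    obtain ⟨B', π, hπ, x, hx⟩ := surjective_up_to_refinements_of_epi e (y ≫ kernel.ι f)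
    refine ⟨B', π, hπ, kernel.lift _ x ?_, ?_⟩
    · rw [← reassoc_of% hx]
      simp
    · rw [← cancel_mono (kernel.ι f)]
      simp [m, hx]
  exact isCardinalGenerated_of_epi m h

section

variable [IsCardinalLocallyPresentable A β]

theorem isCardinalGenerated_kernel_of_epi {N Y : A} [IsCardinalPresentable N β]
    [IsCardinalPresentable Y β] (f : N ⟶ Y) [Epi f] : isCardinalGenerated A β (kernel f) := by
  obtain ⟨J, _, _, ⟨p⟩⟩ :=
    (isCardinalFilteredGenerator_isCardinalPresentable A β).exists_colimitsOfShape (kernel f)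
  obtain ⟨j, hj⟩ := exists_epi_of_isColimit_of_exact β p.isColimit (kernel.ι f) f
    (kernel.condition f) (ShortComplex.exact_kernel f)
  exact ⟨_, _, p.prop_diag_obj j, hj⟩

theorem exists_isCardinalPresentable_epi {W X : A} (g : W ⟶ X) [Epi g]
    [IsCardinalPresentable X β] :
    ∃ (N : A) (p : N ⟶ W), IsCardinalPresentable N β ∧ Epi (p ≫ g) := by
  obtain ⟨J, _, _, ⟨p⟩⟩ :=
    (isCardinalFilteredGenerator_isCardinalPresentable A β).exists_colimitsOfShape W
  obtain ⟨j, hj⟩ := exists_epi_of_isColimit β p.isColimit g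
  exact ⟨_, _, p.prop_diag_obj j, hj⟩

end

variable [LocallySmall.{v} A]

theorem isCardinalPresentable_biprod {X Y : A} (hX : IsCardinalPresentable X β)
    (hY : IsCardinalPresentable Y β) : IsCardinalPresentable (X ⊞ Y) β := by
  have := isClosedUnderFiniteColimits_isCardinalPresentable (A := A) (β := β)
    (J := Discrete WalkingPair)
  refine (isCardinalPresentable A β).prop_of_isColimit (BinaryBiproduct.isColimit X Y) ?_
  rintro ⟨_ | _⟩
  exacts [hX, hY]

/-- Coherence is used twice: for `Y` it covers `ker f` by some `N₀`, and for `X` it covers the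
kernel of `N₀ ⟶ X`, which is the kernel of `N₀ ⟶ ker f`. Thus `ker f` is a cokernel of a map between
`β`-presentable objects. -/
theorem isCardinalPresentable_kernel (h : isCardinalPresentable A β ≤ isCardinalCoherent A β)
    {X Y : A} [hX : IsCardinalPresentable X β] (hY : IsCardinalPresentable Y β) (f : X ⟶ Y) :
    IsCardinalPresentable (kernel f) β := by
  obtain ⟨N₀, p, hN₀, hp⟩ := h _ hY f hX
  obtain ⟨N₁, q, hN₁, hq⟩ := h _ hX (p ≫ kernel.ι f) hN₀
  have hz : (q ≫ kernel.ι (p ≫ kernel.ι f)) ≫ p = 0 := by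
    rw [← cancel_mono (kernel.ι f)]
    simp
  have hex : (ShortComplex.mk _ _ hz).Exact := by
    rw [ShortComplex.exact_iff_exact_up_to_refinements]
    intro B x hx
    obtain ⟨B', π, hπ, y, hy⟩ := surjective_up_to_refinements_of_epi q
      (kernel.lift (p ≫ kernel.ι f) x (by simp [reassoc_of% hx]))
    refine ⟨B', π, hπ, y, ?_⟩
    simpa using hy =≫ kernel.ι _
  have : Epi (ShortComplex.mk _ _ hz).g := hp
  exact (isCardinalPresentable A β).prop_of_isColimit_cokernelCofork hex.gIsCokernel hN₁ hN₀

end Coherence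

/-! ### Covers by `β`-small coproducts of `κ`-presentable objects. -/

section Finset

theorem hasCardinalLT_finset {I : Type u} {β : Cardinal.{u}} [Fact β.IsRegular]
    (hI : HasCardinalLT I β) : HasCardinalLT (Finset I) β := by
  cases finite_or_infinite I
  · exact hasCardinalLT_of_finite _ _ (Cardinal.IsRegular.aleph0_le Fact.out)
  · rw [hasCardinalLT_iff_cardinal_mk_lt] at hI ⊢
    rwa [Cardinal.mk_finset_of_infinite]

end Finset

section SigmaCover

variable {A : Type u} [Category.{v} A] [Abelian A]
  {κ β : Cardinal.{v}} [Fact κ.IsRegular] [Fact β.IsRegular]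

/-- Every `β`-presentable object is a quotient of a `β`-small coproduct of `κ`-presentable
objects. -/
theorem exists_epi_sigma [IsCardinalLocallyPresentable A κ] (h : κ ≤ β) (Y : A)
    [hY : IsCardinalPresentable Y β] :
    ∃ (I : Type v) (X : I → A) (p : ∐ X ⟶ Y), HasCardinalLT I β ∧
      (∀ i, IsCardinalPresentable (X i) κ) ∧ Epi p := by
  obtain ⟨P, _, hP₁, hP₂⟩ :=
    (IsCardinalLocallyPresentable.iff_exists_isStrongGenerator A κ).1 inferInstance
  let T : ObjectProperty A := fun Y => ∃ (I : Type v) (X : I → A) (p : ∐ X ⟶ Y),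
    HasCardinalLT I β ∧ (∀ i, IsCardinalPresentable (X i) κ) ∧ Epi p
  have : T.IsClosedUnderIsomorphisms :=
    ⟨fun e ⟨I, X, p, hI, hX, hp⟩ => ⟨I, X, p ≫ e.hom, hI, hX, inferInstance⟩⟩
  -- The `β`-presentable objects are the closure of `P` under `β`-small colimits, so it suffices
  -- that `T` contains `P` and is stable under such colimits. A colimit is a quotient of the
  -- coproduct of its terms, and regularity of `β` keeps the combined index set small.
  have key : P.colimitsCardinalClosure β ≤ T := by
    refine P.colimitsCardinalClosure_le β (fun J _ hJ => ⟨?_⟩) ?_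
    · rintro Y ⟨c⟩
      choose I X p hI hX hp using c.prop_diag_obj
      refine ⟨Σ j, I j, fun k => X k.1 k.2,
        Limits.Sigma.desc fun k => Limits.Sigma.ι (X k.1) k.2 ≫ p k.1 ≫ c.ι.app k.1,
        hasCardinalLT_sigma _ _ (hasCardinalLT_of_hasCardinalLT_arrow hJ) hI,
        fun k => hX k.1 k.2, Preadditive.epi_of_cancel_zero _ fun {Z} g hg => ?_⟩
      refine c.isColimit.hom_ext fun j => ?_
      rw [← cancel_epi (p j)]
      refine Limits.Sigma.hom_ext _ _ fun i => ?_
      have := Limits.Sigma.ι (fun k : Σ j, I j => X k.1 k.2) ⟨j, i⟩ ≫= hg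
      simpa using this
    · intro X hX
      exact ⟨PUnit, fun _ => X, Limits.Sigma.desc fun _ => 𝟙 X,
        hasCardinalLT_of_finite _ _ (Cardinal.IsRegular.aleph0_le Fact.out),
        fun _ => hP₂ _ hX, (⟨⟨Limits.Sigma.ι (fun _ : PUnit => X) ⟨⟩, by simp⟩⟩ :
          IsSplitEpi _).epi⟩
  refine key _ ?_
  rw [← IsStrongGenerator.colimitsCardinalClosure_eq_isCardinalPresentable hP₁
    (hP₂.trans (isCardinalPresentable_monotone A h))]
  exact hY

end SigmaCover

/-! ### Closure under kernels passes from `κ` to `β`. -/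

section Grothendieck

open CoproductsFromFiniteFiltered

variable {A : Type u} [Category.{v} A] [Abelian A] [IsGrothendieckAbelian.{v} A]

/-- The inclusion of the coproduct of a finite subfamily. -/
noncomputable def finiteSubcoproductι {C : Type*} [Category* C] [HasFiniteCoproducts C] {I : Type*}
    (X : I → C) [HasCoproduct X] (F : Finset (Discrete I)) :
    (∐ fun x : F => X x.1.as) ⟶ ∐ X :=
  Limits.Sigma.desc fun x => Limits.Sigma.ι X x.1.as

attribute [local instance] IsFiltered.isConnected in
-- The coproduct is the filtered colimit of its finite subcoproducts. Filtered colimits being exact,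
-- `Z` is exhausted by their pullbacks along `f`, and vanishing can be checked there.
theorem comp_eq_zero_of_finiteSubcoproductι {I : Type v} {X : I → A} {Y Z : A} {f : Z ⟶ ∐ X}
    {g : ∐ X ⟶ Y} (h : ∀ (F : Finset (Discrete I)) (W : A) (a : W ⟶ ∐ fun x : F => X x.1.as)
      (b : W ⟶ Z), b ≫ f = a ≫ finiteSubcoproductι X F → b ≫ f ≫ g = 0) : f ≫ g = 0 :=
  (isColimitFiniteSubproductsCocone X).pullback_zero_ext fun F =>
    h F _ (pullback.fst ((finiteSubcoproductsCocone X).ι.app F) f) _ pullback.condition.symm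

/-- The kernel of a morphism from a coproduct is covered by the kernels of its restrictions to
the finite subcoproducts. -/
theorem exists_epi_sigma_kernel {I : Type v} (X : I → A) {Z : A} (g : ∐ X ⟶ Z) :
    ∃ d : (∐ fun F : Finset (Discrete I) => kernel (finiteSubcoproductι X F ≫ g)) ⟶ kernel g,
      Epi d := by
  let d := Limits.Sigma.desc fun F : Finset (Discrete I) =>
      kernel.lift g (kernel.ι (finiteSubcoproductι X F ≫ g) ≫ finiteSubcoproductι X F) (by simp)
  refine ⟨d, ?_⟩
  have hz : kernel.ι g ≫ cokernel.π (d ≫ kernel.ι g) = 0 := by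
    refine comp_eq_zero_of_finiteSubcoproductι fun F W a b hab => ?_
    obtain ⟨a, rfl⟩ : ∃ a', a = a' ≫ kernel.ι (finiteSubcoproductι X F ≫ g) :=
      ⟨kernel.lift (finiteSubcoproductι X F ≫ g) a (by
        rw [← reassoc_of% hab, kernel.condition, comp_zero]), by simp⟩
    have h₂ : kernel.ι (finiteSubcoproductι X F ≫ g) ≫ finiteSubcoproductι X F =
        Limits.Sigma.ι (fun F => kernel (finiteSubcoproductι X F ≫ g)) F ≫ d ≫ kernel.ι g := by
      simp [d]
    rw [reassoc_of% hab, reassoc_of% h₂, ← Category.assoc d,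
      cokernel.condition, comp_zero, comp_zero]
  refine (epi_iff_surjective_up_to_refinements _).2 fun B y => ?_
  obtain ⟨B', π, hπ, x, hx⟩ :=
    (ShortComplex.exact_cokernel (d ≫ kernel.ι g)).exact_up_to_refinements
      (y ≫ kernel.ι g) (by rw [Category.assoc, hz, comp_zero])
  refine ⟨B', π, hπ, x, (cancel_mono (kernel.ι g)).1 ?_⟩
  simpa using hx

variable {κ β : Cardinal.{v}} [Fact κ.IsRegular] [Fact β.IsRegular]

/-- The map lands in a `κ`-small subcoproduct, which is `κ`-presentable; its inclusion is a
monomorphism, so the kernel does not change. -/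
theorem isCardinalPresentable_kernel_sigma [(isCardinalPresentable A κ).IsClosedUnderKernels]
    {J : Type v} (Y : J → A) (hY : ∀ j, IsCardinalPresentable (Y j) κ) {X : A}
    [hX : IsCardinalPresentable X κ] (f : X ⟶ ∐ Y) : IsCardinalPresentable (kernel f) κ := by
  obtain ⟨S, g, rfl⟩ := exists_comp_subcoproductsι_eq κ Y f
  have : isCardinalPresentable A κ (kernel g) :=
    (isCardinalPresentable A κ).prop_kernel g hX
      (isCardinalPresentable_sigma S.2 _ fun x => hY x.1)
  exact (isCardinalPresentable A κ).prop_of_iso (kernelCompMono g _).symm this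

theorem isCardinalCoherent_sigma [IsCardinalLocallyPresentable A κ] (h : κ ≤ β)
    [(isCardinalPresentable A κ).IsClosedUnderKernels]
    {J : Type v} (Y : J → A) (hY : ∀ j, IsCardinalPresentable (Y j) κ) :
    isCardinalCoherent A β (∐ Y) := by
  intro N f hN
  obtain ⟨I, X, p, hI, hX, hp⟩ := exists_epi_sigma h N
  obtain ⟨d, hd⟩ := exists_epi_sigma_kernel X (p ≫ f)
  refine isCardinalGenerated_kernel_of_epi_comp p f ⟨_, d, ?_, hd⟩
  refine isCardinalPresentable_sigma (hasCardinalLT_finset ?_) _ fun F => ?_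
  · exact hI.of_injective (fun i => i.as) (fun _ _ h => Discrete.ext h)
  · have : IsCardinalPresentable (∐ fun x : F => X x.1.as) κ :=
      isCardinalPresentable_sigma
        (hasCardinalLT_of_finite _ _ (Cardinal.IsRegular.aleph0_le Fact.out)) _ fun x => hX x.1.as
    have := isCardinalPresentable_kernel_sigma Y hY
      (finiteSubcoproductι X F ≫ p ≫ f)
    exact isCardinalPresentable_of_le _ h

theorem isCardinalPresentable_le_isCardinalCoherent [IsCardinalLocallyPresentable A κ] (h : κ ≤ β)
    [(isCardinalPresentable A κ).IsClosedUnderKernels] :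
    isCardinalPresentable A β ≤ isCardinalCoherent A β := by
  intro Y hY N f hN
  have := IsCardinalLocallyPresentable.of_le A h
  have : IsCardinalPresentable Y β := hY
  obtain ⟨I, X, q, hI, hX, hq⟩ := exists_epi_sigma h Y
  have hP : IsCardinalPresentable (∐ X) β :=
    isCardinalPresentable_sigma hI X fun i => by
      have := hX i
      exact isCardinalPresentable_of_le _ h
  obtain ⟨K, k, hK, hk⟩ := isCardinalGenerated_kernel_of_epi (β := β) q
  obtain ⟨N', e, hN', he⟩ := exists_isCardinalPresentable_epi (β := β) (pullback.fst f q)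
  refine isCardinalGenerated_kernel_of_epi_comp (e ≫ pullback.fst f q) f ?_
  -- An element of `N'` dies in `Y` exactly when its lift to `∐ X` lies in `ker q`, which is the
  -- image of `K`. Hence `ker φ` covers the wanted kernel, and `φ` has a coproduct of
  -- `κ`-presentable objects as target.
  let φ : N' ⊞ K ⟶ ∐ X := biprod.desc (e ≫ pullback.snd f q) (k ≫ kernel.ι q)
  let m : kernel φ ⟶ kernel ((e ≫ pullback.fst f q) ≫ f) := kernel.lift _ (kernel.ι φ ≫ biprod.fst) (by
    have hφ : φ ≫ q = biprod.fst ≫ (e ≫ pullback.fst f q) ≫ f := by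
      ext
      · simp [φ, pullback.condition]
      · simp [φ]
    rw [Category.assoc, ← hφ, kernel.condition_assoc, zero_comp])
  have : Epi m := by
    refine (epi_iff_surjective_up_to_refinements m).2 fun B y => ?_
    let x := y ≫ kernel.ι _
    have hx : (x ≫ e ≫ pullback.snd f q) ≫ q = 0 := by
      have : y ≫ kernel.ι _ ≫ ((e ≫ pullback.fst f q) ≫ f) = 0 := by
        rw [kernel.condition, comp_zero]
      simpa [x, pullback.condition] using this
    obtain ⟨B', π, hπ, z, hz⟩ := surjective_up_to_refinements_of_epi k (kernel.lift q _ hx)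
    refine ⟨B', π, hπ, kernel.lift φ (biprod.lift (π ≫ x) (-z)) ?_, ?_⟩
    · have := hz =≫ kernel.ι q
      simp only [Category.assoc, kernel.lift_ι] at this
      simp [φ, this]
    · rw [← cancel_mono (kernel.ι _)]
      simp [m, x]
  exact isCardinalGenerated_of_epi m
    (isCardinalCoherent_sigma h X hX φ (isCardinalPresentable_biprod hN' hK))

/-- If the `κ`-presentable objects are closed under kernels, then so are the `β`-presentable
objects for every `β ≥ κ`. -/
theorem isClosedUnderKernels_isCardinalPresentable_of_le [IsCardinalLocallyPresentable A κ]
    (h : κ ≤ β) [(isCardinalPresentable A κ).IsClosedUnderKernels] :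
    (isCardinalPresentable A β).IsClosedUnderKernels where
  kernels_le := by
    rintro _ ⟨f, k, hk, hf⟩
    have := hf.1
    have : IsCardinalPresentable _ β := hf.1
    exact (isCardinalPresentable A β).prop_of_iso
      ((limit.isLimit _).conePointUniqueUpToIso hk)
      (isCardinalPresentable_kernel (isCardinalPresentable_le_isCardinalCoherent h) hf.2 f)

end Grothendieck

/-! ### Exactness of a left adjoint determined on a generator. -/

section FiniteCoproduct

theorem sum_sigmaπ_comp_sigmaι {C : Type*} [Category* C] [Preadditive C] {J : Type*} [Fintype J]
    [DecidableEq J]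
    (Y : J → C) [HasCoproduct Y] : ∑ j, Limits.Sigma.π Y j ≫ Limits.Sigma.ι Y j = 𝟙 (∐ Y) := by
  refine Limits.Sigma.hom_ext _ _ fun i => ?_
  rw [Preadditive.comp_sum, Finset.sum_eq_single i]
  · simp
  · intro j _ hj
    rw [Limits.Sigma.ι_π_of_ne_assoc _ hj.symm, zero_comp]
  · simp

end FiniteCoproduct

section Reflective

universe v₁ u₁

variable {M : Type u₁} [Category.{v₁} M] {A : Type u} [Category.{v} A] {Q : M ⥤ A} {R : A ⥤ M}
  (adj : Q ⊣ R)

include adj in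
theorem Adjunction.exists_map_eq_of_isIso_unit {X Y : M} [IsIso (adj.unit.app Y)]
    (f : Q.obj X ⟶ Q.obj Y) : ∃ g : X ⟶ Y, Q.map g = f := by
  refine ⟨adj.unit.app X ≫ R.map f ≫ inv (adj.unit.app Y), ?_⟩
  have : Q.map (inv (adj.unit.app Y)) = adj.counit.app (Q.obj Y) := by
    rw [← cancel_epi (Q.map (adj.unit.app Y)), ← Q.map_comp]
    simp
  simp [this]

theorem exists_epi_sigma_of_isStrongGenerator [HasCoproducts.{v} M] [LocallySmall.{v} M]
    {P : ObjectProperty M} [ObjectProperty.Small.{v} P] (hP : P.IsStrongGenerator) (X : M) :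
    ∃ (I : Type v) (s : I → M) (_ : ∀ i, P (s i)) (p : ∐ s ⟶ X), Epi p := by
  obtain ⟨I, s, hs, c, hc, p, hp⟩ := ObjectProperty.isStrongGenerator_iff_exists_extremalEpi.1 hP X
  exact ⟨I, s, hs, ((colimit.isColimit _).coconePointUniqueUpToIso hc).hom ≫ p, epi_comp _ _⟩

/-- A map `G ⟶ ∐ s` killed by the unit has zero components, since the unit is invertible on each `s
i`. As `G` is finitely presentable, the map lands in a finite subcoproduct and is the sum of its
components. -/
theorem Adjunction.mono_unit_sigma [Abelian M] [HasCoproducts.{v} M]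
    {P : ObjectProperty M} (hP : P.IsSeparating)
    (hη : ∀ X, P X → IsIso (adj.unit.app X)) [Fact Cardinal.aleph0.{v}.IsRegular]
    (hP' : P ≤ isCardinalPresentable M Cardinal.aleph0.{v}) {I : Type v} (s : I → M)
    (hs : ∀ i, P (s i)) : Mono (adj.unit.app (∐ s)) := by
  classical
  refine Preadditive.mono_of_kernel_zero (hP _ _ fun G hG t => ?_)
  rw [comp_zero]
  set g := t ≫ kernel.ι (adj.unit.app (∐ s)) with hg
  have hgη : g ≫ adj.unit.app (∐ s) = 0 := by simp [hg]
  have hG' : IsCardinalPresentable G Cardinal.aleph0.{v} := hP' _ hG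
  obtain ⟨S, g', hg'⟩ := exists_comp_subcoproductsι_eq Cardinal.aleph0.{v} s g
  have : Finite S.1 := (hasCardinalLT_aleph0_iff _).1 S.2
  have := Fintype.ofFinite S.1
  have hπ (i : I) : g ≫ Limits.Sigma.π s i = 0 := by
    have := hη _ (hs i)
    rw [← cancel_mono (adj.unit.app (s i)), Category.assoc]
    have := adj.unit_naturality (Limits.Sigma.π s i)
    rw [← this, reassoc_of% hgη, zero_comp, zero_comp]
  have h₀ : g' = 0 := by
    rw [← Category.comp_id g', ← sum_sigmaπ_comp_sigmaι, Preadditive.comp_sum]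
    refine Finset.sum_eq_zero fun x _ => ?_
    have : Limits.Sigma.π (fun x : S.1 => s x.1) x =
        subcoproductsι _ s S ≫ Limits.Sigma.π s x.1 := by
      refine Limits.Sigma.hom_ext _ _ fun y => ?_
      rw [ι_subcoproductsι_assoc]
      by_cases h : y = x
      · subst h
        simp
      · rw [Limits.Sigma.ι_π_of_ne _ h, Limits.Sigma.ι_π_of_ne _ (fun h' => h (Subtype.ext h'))]
    rw [this, ← Category.assoc, ← Category.assoc, hg', hπ, zero_comp]
  rw [← hg', h₀, zero_comp]

variable [Abelian M] [Abelian A]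

include adj in
theorem Adjunction.eq_zero_of_isSeparating [R.Faithful] [Q.Additive] [R.Additive] {P : ObjectProperty M}
    (hP : P.IsSeparating) {X Y : A} (f : X ⟶ Y)
    (h : ∀ (G : M) (_ : P G) (g : Q.obj G ⟶ X), g ≫ f = 0) : f = 0 := by
  apply R.map_injective
  refine hP _ _ fun G hG g => ?_
  rw [R.map_zero, comp_zero]
  have := h G hG ((adj.homEquiv _ _).symm g)
  rw [← adj.homEquiv_naturality_right_symm] at this
  apply (adj.homEquiv _ _).symm.injective
  rw [this]
  simp [adj.homEquiv_counit]

variable [Q.Additive] [R.Additive] [R.Faithful] [IsGrothendieckAbelian.{v} A]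
  [HasCoproducts.{v} M] [LocallySmall.{v} M] {P : ObjectProperty M} [ObjectProperty.Small.{v} P]

theorem Adjunction.mono_homEquiv_symm (hP : P.IsStrongGenerator)
    (hη : ∀ X, P X → IsIso (adj.unit.app X)) {K : M} {B : A} (m : K ⟶ R.obj B) [Mono m] :
    Mono ((adj.homEquiv K B).symm m) := by
  classical
  obtain ⟨I, s, hs, p, hp⟩ := exists_epi_sigma_of_isStrongGenerator hP K
  have := adj.leftAdjoint_preservesColimits
  set m' := (adj.homEquiv K B).symm m with hm'
  let ψ : (∐ fun i => Q.obj (s i)) ⟶ Q.obj K := sigmaComparison Q s ≫ Q.map p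
  have : Epi (Q.map p) := inferInstance
  have : Epi ψ := inferInstance
  -- Everything in `∐ Q (s i)` killed by `ψ ≫ m'` is to be killed by `ψ`. Test on maps from `Q G`
  -- into finite subcoproducts: these come from maps `G ⟶ ∐ s`, whose composite to `R B` vanishes by
  -- transposition, so that the composite to `K` vanishes because `m` is a monomorphism.
  have key : kernel.ι (ψ ≫ m') ≫ ψ = 0 := by
    refine comp_eq_zero_of_finiteSubcoproductι fun F W a b hab => ?_
    refine adj.eq_zero_of_isSeparating hP.isSeparating _ fun G hG h => ?_
    have hw (x : F) : ∃ w : G ⟶ s x.1.as,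
        Q.map w = h ≫ a ≫ Limits.Sigma.π (fun x : F => Q.obj (s x.1.as)) x := by
      have := hη _ (hs x.1.as)
      exact adj.exists_map_eq_of_isIso_unit _
    choose w hw using hw
    have hsum : Q.map (∑ x, w x ≫ Limits.Sigma.ι s x.1.as) =
        h ≫ b ≫ kernel.ι (ψ ≫ m') ≫ sigmaComparison Q s := by
      have h₁ : a = a ≫ ∑ x, Limits.Sigma.π (fun x : F => Q.obj (s x.1.as)) x ≫
          Limits.Sigma.ι (fun x : F => Q.obj (s x.1.as)) x := by
        rw [sum_sigmaπ_comp_sigmaι, Category.comp_id]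
      rw [reassoc_of% hab, h₁]
      simp [finiteSubcoproductι, Preadditive.comp_sum, Preadditive.sum_comp, hw]
    have h₂ : h ≫ b ≫ kernel.ι (ψ ≫ m') ≫ ψ =
        Q.map ((∑ x, w x ≫ Limits.Sigma.ι s x.1.as) ≫ p) := by
      rw [Q.map_comp, hsum]
      simp [ψ]
    have h₃ : ((∑ x, w x ≫ Limits.Sigma.ι s x.1.as) ≫ p) ≫ m = 0 := by
      apply (adj.homEquiv _ _).symm.injective
      rw [adj.homEquiv_naturality_left_symm, ← hm', ← h₂]
      simp [adj.homEquiv_counit]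
    rw [h₂, zero_of_comp_mono m h₃, Q.map_zero]
  refine Preadditive.mono_of_cancel_zero _ fun {T} t ht => ?_
  obtain ⟨T', π, hπ, x, hx⟩ := surjective_up_to_refinements_of_epi ψ t
  have hx' : x ≫ ψ ≫ m' = 0 := by rw [← reassoc_of% hx, ht, comp_zero]
  have : x ≫ ψ = 0 := by
    rw [← kernel.lift_ι _ _ hx', Category.assoc, key, comp_zero]
  rw [← cancel_epi π, hx, this, comp_zero]

theorem Adjunction.preservesMonomorphisms_of_isStrongGenerator (hP : P.IsStrongGenerator)
    (hη : ∀ X, P X → IsIso (adj.unit.app X)) [Fact Cardinal.aleph0.{v}.IsRegular]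
    (hP' : P ≤ isCardinalPresentable M Cardinal.aleph0.{v}) : Q.PreservesMonomorphisms where
  preserves {F' F} i _ := by
    obtain ⟨I, s, hs, p, hp⟩ := exists_epi_sigma_of_isStrongGenerator hP F
    have := adj.leftAdjoint_preservesColimits
    have := adj.mono_unit_sigma hP.isSeparating hη hP' s hs
    -- The pullback is a submodule of `∐ s`, hence of `R (Q (∐ s))` through the unit, and the
    -- transpose of that inclusion is `Q.map (pullback.fst p i)`.
    have hj : Mono (Q.map (pullback.fst p i)) := by
      have := adj.mono_homEquiv_symm hP hη (pullback.fst p i ≫ adj.unit.app (∐ s))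
      simpa [adj.homEquiv_counit] using this
    let k : kernel p ⟶ pullback p i := pullback.lift (kernel.ι p) 0 (by simp)
    have hk : k ≫ pullback.snd p i = 0 := pullback.lift_snd _ _ _
    have hk' : k ≫ pullback.fst p i = kernel.ι p := pullback.lift_fst _ _ _
    have hc := CokernelCofork.mapIsColimit _ (Abelian.epiIsCokernelOfKernel _ (kernelIsKernel p)) Q
    refine Preadditive.mono_of_cancel_zero _ fun {T} t ht => ?_
    have : Epi (Q.map (pullback.snd p i)) := inferInstance
    obtain ⟨T', π, hπ, x, hx⟩ :=
      surjective_up_to_refinements_of_epi (Q.map (pullback.snd p i)) t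
    have hx' : (x ≫ Q.map (pullback.fst p i)) ≫ Q.map p = 0 := by
      rw [Category.assoc, ← Q.map_comp, pullback.condition, Q.map_comp, ← reassoc_of% hx, ht,
        comp_zero]
    obtain ⟨T'', π', hπ', y, hy⟩ :=
      -- `Q` preserves cokernels, so an element killed by `Q p` comes from `Q (ker p)`. Since `ker
      -- p` sits in the pullback and maps to zero in `F'`, the given element `t` is zero.
      (CokernelCofork.IsColimit.comp_π_eq_zero_iff_up_to_refinements hc _).1 hx'
    have hxy : π' ≫ x = y ≫ Q.map k := by
      rw [← cancel_mono (Q.map (pullback.fst p i)), Category.assoc, Category.assoc, ← Q.map_comp, hk']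
      simpa using hy
    rw [← cancel_epi π, ← cancel_epi π', hx, reassoc_of% hxy, ← Q.map_comp, hk]
    simp

theorem Adjunction.preservesFiniteLimits_of_isStrongGenerator (hP : P.IsStrongGenerator)
    (hη : ∀ X, P X → IsIso (adj.unit.app X)) [Fact Cardinal.aleph0.{v}.IsRegular]
    (hP' : P ≤ isCardinalPresentable M Cardinal.aleph0.{v}) : PreservesFiniteLimits Q := by
  have := adj.preservesMonomorphisms_of_isStrongGenerator hP hη hP'
  have := adj.leftAdjoint_preservesColimits
  have : Q.PreservesHomology := Q.preservesHomology_of_preservesMonos_and_cokernels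
  exact Q.preservesFiniteLimits_of_preservesHomology

end Reflective

/-! ### Accessibility of the right adjoint. -/

section Accessible

universe v₁ u₁

variable {M : Type u₁} [Category.{v₁} M] {A : Type u} [Category.{v} A] {Q : M ⥤ A} {R : A ⥤ M}
  (adj : Q ⊣ R) {κ : Cardinal.{v}} [Fact κ.IsRegular]

include adj in
/-- A right adjoint is `κ`-accessible if its left adjoint maps a strong generator of
`κ`-presentable objects to `κ`-presentable objects. -/
theorem Adjunction.isCardinalAccessible_of_isStrongGenerator [HasColimitsOfSize.{v, v} M]
    {P : ObjectProperty M} (hP : P.IsStrongGenerator) (hP' : P ≤ isCardinalPresentable M κ)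
    (hQ : ∀ X, P X → IsCardinalPresentable (Q.obj X) κ) : R.IsCardinalAccessible κ where
  preservesColimitOfShape J _ _ := ⟨fun {F} => ⟨fun {c} hc => ⟨by
    have := isFiltered_of_isCardinalFiltered J κ
    let d : colimit (F ⋙ R) ⟶ R.obj c.pt := colimit.desc (F ⋙ R) (R.mapCocone c)
    have hd (j : J) : colimit.ι (F ⋙ R) j ≫ d = R.map (c.ι.app j) := colimit.ι_desc _ _
    -- Both halves are tested on generators by transposing to `A`: presentability of `Q G` equalises
    -- two maps at a later stage here, and factors a single map through a stage below.
    have : Mono d := by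
      rw [hP.isSeparating.mono_iff]
      intro G hG g₁ g₂ h
      have : IsCardinalPresentable G κ := hP' _ hG
      have := hQ _ hG
      obtain ⟨j, f₁, f₂, rfl, rfl⟩ : ∃ (j : J) (f₁ f₂ : G ⟶ R.obj (F.obj j)),
          f₁ ≫ colimit.ι (F ⋙ R) j = g₁ ∧ f₂ ≫ colimit.ι (F ⋙ R) j = g₂ := by
        obtain ⟨j₁, f₁, hf₁⟩ :=
          IsCardinalPresentable.exists_hom_of_isColimit κ (colimit.isColimit _) g₁
        obtain ⟨j₂, f₂, hf₂⟩ :=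
          IsCardinalPresentable.exists_hom_of_isColimit κ (colimit.isColimit _) g₂
        refine ⟨IsFiltered.max j₁ j₂, f₁ ≫ (F ⋙ R).map (IsFiltered.leftToMax j₁ j₂),
          f₂ ≫ (F ⋙ R).map (IsFiltered.rightToMax j₁ j₂), ?_, ?_⟩
        · rw [← hf₁]
          exact (Category.assoc _ _ _).trans (congrArg (f₁ ≫ ·) (colimit.w _ _))
        · rw [← hf₂]
          exact (Category.assoc _ _ _).trans (congrArg (f₂ ≫ ·) (colimit.w _ _))
      have h' : f₁ ≫ R.map (c.ι.app j) = f₂ ≫ R.map (c.ι.app j) := by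
        rw [← hd]
        exact (Category.assoc _ _ _).symm.trans (h.trans (Category.assoc _ _ _))
      have h'' : (adj.homEquiv _ _).symm f₁ ≫ c.ι.app j =
          (adj.homEquiv _ _).symm f₂ ≫ c.ι.app j := by
        rw [← adj.homEquiv_naturality_right_symm, ← adj.homEquiv_naturality_right_symm]
        exact congrArg _ h'
      obtain ⟨k, u, hu⟩ := IsCardinalPresentable.exists_eq_of_isColimit' κ hc _ _ h''
      rw [← adj.homEquiv_naturality_right_symm, ← adj.homEquiv_naturality_right_symm] at hu
      have hu' : f₁ ≫ (F ⋙ R).map u = f₂ ≫ (F ⋙ R).map u := (adj.homEquiv _ _).symm.injective hu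
      rw [← colimit.w (F ⋙ R) u, ← Category.assoc, ← Category.assoc, hu']
    have : IsIso d := hP.isIso_of_mono d fun G hG g => by
      have := hQ _ hG
      obtain ⟨j, f, hf⟩ :=
        IsCardinalPresentable.exists_hom_of_isColimit κ hc ((adj.homEquiv _ _).symm g)
      refine ⟨adj.homEquiv _ _ f ≫ colimit.ι (F ⋙ R) j, ?_⟩
      refine (Category.assoc _ _ _).trans ?_
      rw [hd, ← adj.homEquiv_naturality_right]
      exact (adj.homEquiv _ _).symm_apply_eq.1 hf.symm |>.symm
    have : IsIso ((colimit.isColimit (F ⋙ R)).desc (R.mapCocone c)) := this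
    exact IsColimit.ofPointIso (colimit.isColimit (F ⋙ R))⟩⟩⟩

end Accessible

/-! ### Cofinal subdiagrams and objects killed by `Q`. -/

section Cofinal

universe v₁ u₁

variable {M : Type u₁} [Category.{v₁} M] {κ : Cardinal.{v}} [Fact κ.IsRegular]

/-- If every morphism from a `κ`-presentable object to `F` factors through a `κ`-presentable
object satisfying `E`, then `F` is a `κ`-filtered colimit of objects satisfying `E`. -/
theorem exists_colimitsOfShape_of_factors [IsCardinalAccessibleCategory M κ]
    {E : ObjectProperty M} (hE : E ≤ isCardinalPresentable M κ) (F : M)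
    (h : ∀ (G : M) (_ : IsCardinalPresentable G κ) (g : G ⟶ F),
      ∃ (X : M) (_ : E X) (a : G ⟶ X) (b : X ⟶ F), a ≫ b = g) :
    ∃ (J : Type v) (_ : SmallCategory J), IsCardinalFiltered J κ ∧ E.colimitsOfShape J F := by
  let Φ : CostructuredArrow (ObjectProperty.ιOfLE hE ⋙ (isCardinalPresentable M κ).ι) F ⥤
    CostructuredArrow (isCardinalPresentable M κ).ι F := CostructuredArrow.pre _ _ _
  have hΦ (d : CostructuredArrow (isCardinalPresentable M κ).ι F) :
      ∃ e, Nonempty (d ⟶ Φ.obj e) := by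
    obtain ⟨X, hX, a, b, hab⟩ := h _ d.left.property d.hom
    exact ⟨CostructuredArrow.mk (S := ObjectProperty.ιOfLE hE ⋙ (isCardinalPresentable M κ).ι)
      (Y := (⟨X, hX⟩ : E.FullSubcategory)) b,
      ⟨CostructuredArrow.homMk (ObjectProperty.homMk a) hab⟩⟩
  have := isFiltered_of_isCardinalFiltered (CostructuredArrow (isCardinalPresentable M κ).ι F) κ
  -- The objects of `E` over `F` are cofinal in the canonical diagram of `κ`-presentable objects
  -- over `F`, so they have the same colimit `F`.
  have : Φ.Final := Functor.final_of_exists_of_isFiltered_of_fullyFaithful Φ hΦ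
  have : IsCardinalFiltered
      (CostructuredArrow (ObjectProperty.ιOfLE hE ⋙ (isCardinalPresentable M κ).ι) F) κ := ⟨by
    intro K _ G hK
    let c := IsCardinalFiltered.cocone (G ⋙ Φ) hK
    obtain ⟨e, ⟨f⟩⟩ := hΦ c.pt
    exact ⟨{ pt := e
             ι :=
              { app k := Φ.preimage (c.ι.app k ≫ f)
                naturality i j g := Φ.map_injective (by
                  have := c.w g
                  dsimp at this
                  simp [reassoc_of% this]) } }⟩⟩
  have : EssentiallySmall.{v}
      (CostructuredArrow (ObjectProperty.ιOfLE hE ⋙ (isCardinalPresentable M κ).ι) F) :=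
    essentiallySmall_of_fully_faithful Φ
  let e := equivSmallModel.{v}
    (CostructuredArrow (ObjectProperty.ιOfLE hE ⋙ (isCardinalPresentable M κ).ι) F)
  exact ⟨SmallModel.{v} _, inferInstance, IsCardinalFiltered.of_equivalence κ e,
    ⟨{  diag := _
        ι := _
        isColimit := ((Functor.Final.isColimitWhiskerEquiv Φ _).symm
          ((isCardinalPresentable M κ).ι.denseAt F)).whiskerEquivalence e.symm
        prop_diag_obj j := (e.inverse.obj j).left.property }⟩⟩

end Cofinal

section Kernel

universe v₁ u₁

variable {M : Type u₁} [Category.{v₁} M] [Abelian M] {A : Type u} [Category.{v} A] [Abelian A]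
  {Q : M ⥤ A} {R : A ⥤ M} (adj : Q ⊣ R) {κ : Cardinal.{v}} [Fact κ.IsRegular]

include adj in
-- Since `Q F = 0`, the map `Q (ker g) ⟶ Q G` is epi. As `Q G` is `κ`-presentable, one
-- `κ`-presentable term of a diagram for `ker g` already maps onto `Q G`; the cokernel of that term
-- in `G` is the required object.
theorem Adjunction.exists_factors_of_isZero [PreservesFiniteLimits Q]
    [PreservesFiniteColimits Q] [IsCardinalAccessibleCategory M κ] [R.IsCardinalAccessible κ]
    {F : M} (hF : IsZero (Q.obj F)) (G : M) [hG : IsCardinalPresentable G κ] (g : G ⟶ F) :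
    ∃ (X : M) (_ : isCardinalPresentable M κ X ∧ IsZero (Q.obj X)) (a : G ⟶ X) (b : X ⟶ F),
      a ≫ b = g := by
  obtain ⟨J, _, _, ⟨p⟩⟩ :=
    (isCardinalFilteredGenerator_isCardinalPresentable M κ).exists_colimitsOfShape (kernel g)
  have : Q.Additive := Functor.additive_of_preserves_binary_products _
  have hex := (ShortComplex.exact_kernel g).map Q
  have : Epi (Q.map (kernel.ι g)) := hex.epi_f (hF.eq_of_tgt _ _)
  have := adj.leftAdjoint_preservesColimits
  have := adj.isCardinalPresentable_leftAdjoint_obj κ G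
  obtain ⟨j, hj⟩ := exists_epi_of_isColimit κ (isColimitOfPreserves Q p.isColimit)
    (Q.map (kernel.ι g))
  have hj' : Epi (Q.map (p.ι.app j ≫ kernel.ι g)) := by
    rw [Q.map_comp]
    exact hj
  refine ⟨cokernel (p.ι.app j ≫ kernel.ι g), ⟨?_, ?_⟩, cokernel.π _,
    cokernel.desc _ g (by simp), by simp⟩
  · exact (isCardinalPresentable M κ).prop_cokernel _ (p.prop_diag_obj j) hG
  · rw [IsZero.iff_id_eq_zero, ← cancel_epi (Q.map (cokernel.π _)),
      ← cancel_epi (Q.map (p.ι.app j ≫ kernel.ι g)), ← Q.map_comp_assoc, cokernel.condition]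
    simp

end Kernel

/-! ### Representable modules as a strong generator. -/

section ModCat

variable {C : Type u} [Category.{v} C] [Preadditive C]

/-- The Yoneda lemma for modules, as a bijection. -/
def yonedaModEquiv (X : C) (F : ModCat C) : ((yonedaMod C).obj X ⟶ F) ≃ F.obj.obj (op X) :=
  ((coyonedaYonedaModIso X).app F).toEquiv.trans Equiv.ulift

theorem yonedaModEquiv_comp (X : C) {F G : ModCat C} (f : (yonedaMod C).obj X ⟶ F) (g : F ⟶ G) :
    yonedaModEquiv X G (f ≫ g) = g.hom.app (op X) (yonedaModEquiv X F f) := rfl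

theorem yonedaModEquiv_symm_comp (X : C) {F G : ModCat C} (x : F.obj.obj (op X)) (g : F ⟶ G) :
    (yonedaModEquiv X F).symm x ≫ g = (yonedaModEquiv X G).symm (g.hom.app (op X) x) := by
  apply (yonedaModEquiv X G).injective
  rw [yonedaModEquiv_comp, Equiv.apply_symm_apply, Equiv.apply_symm_apply]

theorem modCat_hom_ext_of_essSurj {D : Type*} [Category* D] (e : D ⥤ C) [e.EssSurj]
    {F G : ModCat C} {f g : F ⟶ G}
    (h : ∀ X, f.hom.app (op (e.obj X)) = g.hom.app (op (e.obj X))) : f = g := by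
  refine ObjectProperty.hom_ext _ (NatTrans.ext (funext fun Y => ?_))
  let p := (e.objObjPreimageIso Y.unop).op
  refine (cancel_mono (G.obj.map p.hom)).1 ?_
  exact (f.hom.naturality p.hom).symm.trans ((congrArg (F.obj.map p.hom ≫ ·) (h _)).trans
    (g.hom.naturality p.hom))

theorem modCat_isIso_of_essSurj {D : Type*} [Category* D] (e : D ⥤ C) [e.EssSurj]
    {F G : ModCat C} (f : F ⟶ G) (h : ∀ X, IsIso (f.hom.app (op (e.obj X)))) : IsIso f := by
  have h' (Y : Cᵒᵖ) : IsIso (f.hom.app Y) := by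
    let p := (e.objObjPreimageIso Y.unop).op
    have := h (e.objPreimage Y.unop)
    have e₁ : F.obj.map p.hom ≫ f.hom.app _ = f.hom.app Y ≫ G.obj.map p.hom :=
      f.hom.naturality p.hom
    have : IsIso (f.hom.app Y ≫ G.obj.map p.hom) := by
      rw [← e₁]; exact inferInstanceAs (IsIso (_ ≫ f.hom.app (op (e.obj _))))
    exact IsIso.of_isIso_comp_right _ (G.obj.map p.hom)
  have : IsIso f.hom := NatIso.isIso_of_isIso_app f.hom
  have : IsIso ((additiveFunctor Cᵒᵖ AddCommGrpCat.{v}).ι.map f) := this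
  exact isIso_of_reflects_iso f (additiveFunctor Cᵒᵖ AddCommGrpCat.{v}).ι

instance : HasColimitsOfSize.{v, v} (ModCat C) :=
  ⟨fun J _ => inferInstanceAs
    (HasColimitsOfShape J (additiveFunctor Cᵒᵖ AddCommGrpCat.{v}).FullSubcategory)⟩

instance locallySmall_modCat [EssentiallySmall.{v} C] : LocallySmall.{v} (ModCat C) where
  hom_small F G := by
    let e := (equivSmallModel.{v} C).inverse
    refine small_of_injective (β := ∀ X : SmallModel.{v} C,
      F.obj.obj (op (e.obj X)) ⟶ G.obj.obj (op (e.obj X)))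
      (f := fun f X => f.hom.app (op (e.obj X))) fun f g h => ?_
    exact modCat_hom_ext_of_essSurj e fun X => congrFun h X

/-- A small set of representable modules. -/
def smallRepresentables (C : Type u) [Category.{v} C] [Preadditive C] [EssentiallySmall.{v} C] :
    ObjectProperty (ModCat C) :=
  .ofObj fun X : SmallModel.{v} C => (yonedaMod C).obj ((equivSmallModel.{v} C).inverse.obj X)

instance [EssentiallySmall.{v} C] : ObjectProperty.Small.{v} (smallRepresentables C) :=
  inferInstanceAs (ObjectProperty.Small.{v} (.ofObj _))

theorem isStrongGenerator_smallRepresentables [EssentiallySmall.{v} C] :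
    (smallRepresentables C).IsStrongGenerator := by
  rw [ObjectProperty.isStrongGenerator_iff]
  let e := (equivSmallModel.{v} C).inverse
  constructor
  · intro F G f g h
    refine modCat_hom_ext_of_essSurj e fun X => ?_
    ext x
    have := h _ (ObjectProperty.ofObj_apply _ X) ((yonedaModEquiv _ F).symm x)
    rw [yonedaModEquiv_symm_comp, yonedaModEquiv_symm_comp] at this
    exact (yonedaModEquiv _ G).symm.injective this
  · intro F G i _ h
    refine modCat_isIso_of_essSurj e i fun X => ?_
    rw [ConcreteCategory.isIso_iff_bijective]
    constructor
    · intro x y hxy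
      apply (yonedaModEquiv _ F).symm.injective
      rw [← cancel_mono i, yonedaModEquiv_symm_comp, yonedaModEquiv_symm_comp]
      exact congrArg _ hxy
    · intro y
      obtain ⟨f, hf⟩ := h _ (ObjectProperty.ofObj_apply _ X) ((yonedaModEquiv _ G).symm y)
      refine ⟨yonedaModEquiv _ F f, ?_⟩
      rw [← yonedaModEquiv_comp]
      exact (congrArg (yonedaModEquiv _ G) hf).trans (Equiv.apply_symm_apply _ _)

theorem smallRepresentables_le [EssentiallySmall.{v} C] (κ : Cardinal.{v}) [Fact κ.IsRegular] :
    smallRepresentables C ≤ isCardinalPresentable (ModCat C) κ := by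
  rintro _ ⟨X⟩
  exact isCardinalPresentable_yonedaMod κ _

instance (κ : Cardinal.{v}) [Fact κ.IsRegular] [EssentiallySmall.{v} C] :
    IsCardinalLocallyPresentable (ModCat C) κ := by
  rw [IsCardinalLocallyPresentable.iff_exists_isStrongGenerator]
  exact ⟨smallRepresentables C, inferInstance, isStrongGenerator_smallRepresentables,
    smallRepresentables_le κ⟩

/-- A functor to `ModCat C` has a left adjoint as soon as `Hom(Hom(-, X), R -)` is corepresentable
for all `X`. -/
theorem isRightAdjoint_of_leftAdjointObjIsDefined_yonedaMod [EssentiallySmall.{v} C]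
    {A : Type*} [Category.{v} A] [HasColimitsOfSize.{v, v} A] (R : A ⥤ ModCat C)
    (h : ∀ X, R.leftAdjointObjIsDefined ((yonedaMod C).obj X)) : R.IsRightAdjoint := by
  refine Functor.isRightAdjoint_of_leftAdjointObjIsDefined_eq_top (top_unique fun F _ => ?_)
  have := Cardinal.fact_isRegular_aleph0.{v}
  have closed (J : Type v) [SmallCategory J] :
      R.leftAdjointObjIsDefined.IsClosedUnderColimitsOfShape J :=
    ⟨fun _ ⟨hc⟩ => Functor.leftAdjointObjIsDefined_of_isColimit hc.isColimit hc.prop_diag_obj⟩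
  have : R.leftAdjointObjIsDefined.IsClosedUnderIsomorphisms :=
    ⟨fun {X Y} e (_ : Functor.IsCorepresentable _) => corepresentable_of_natIso _
      (Functor.isoWhiskerLeft R (coyoneda.mapIso e.symm.op))⟩
  obtain ⟨J, _, _, ⟨p⟩⟩ := (isCardinalFilteredGenerator_isCardinalPresentable (ModCat C)
    Cardinal.aleph0.{v}).exists_colimitsOfShape F
  refine Functor.leftAdjointObjIsDefined_of_isColimit p.isColimit fun j => ?_
  -- The modules where the adjoint is defined are closed under small colimits, and every module is
  -- built from representables by such colimits.
  have hj := (IsStrongGenerator.colimitsCardinalClosure_eq_isCardinalPresentable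
    isStrongGenerator_smallRepresentables (smallRepresentables_le _)).le _ (p.prop_diag_obj j)
  refine ObjectProperty.colimitsCardinalClosure_le _ _ (fun J _ _ => closed J) ?_ _ hj
  rintro _ ⟨X⟩
  exact h _

end ModCat

/-! ### The restricted Yoneda functor and its left adjoint. -/

section

variable (A : Type u) [Category.{v} A] [Preadditive A] (κ : Cardinal.{v}) [Fact κ.IsRegular]

instance : (restrictedYoneda A κ).Additive where
  map_add := by
    intro X Y f g
    refine ObjectProperty.hom_ext _ (NatTrans.ext (funext fun Z => ?_))
    ext a
    exact Preadditive.comp_add _ _ _ a f g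

/-- The restriction of the restricted Yoneda functor to presentable objects is the Yoneda
functor. -/
def yonedaModIsoRestrictedYoneda :
    yonedaMod (presentableObjects A κ) ≅ (isCardinalPresentable A κ).ι ⋙ restrictedYoneda A κ :=
  NatIso.ofComponents (fun X => ObjectProperty.isoMk _ (NatIso.ofComponents (fun Y =>
    AddEquiv.toAddCommGrpIso
      { toFun := fun f : Y.unop ⟶ X => (f.hom : Y.unop.obj ⟶ X.obj)
        invFun := fun f => ObjectProperty.homMk f
        left_inv := fun _ => rfl
        right_inv := fun _ => rfl
        map_add' := fun _ _ => rfl }) (fun _ => rfl))) (fun _ => rfl)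

variable [IsCardinalAccessibleCategory A κ]

instance : (restrictedYoneda A κ).Faithful where
  map_injective {X Y f g} h := by
    refine ((isCardinalPresentable A κ).ι.denseAtEquiv X
      ((isCardinalPresentable A κ).ι.denseAt X)).hom_ext fun p => ?_
    have e (f : X ⟶ Y) : p.hom ≫ f = (𝟙 p.left.obj ≫ p.hom) ≫ f := by rw [Category.id_comp]
    have : p.hom ≫ f = p.hom ≫ g := congr((($h).hom.app (op p.left)).hom p.hom)
    exact (e f).symm.trans (this.trans (e g))

/-- By density `X` is the colimit of the `κ`-presentable objects over it, and naturality of `f` says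
that its values form a cocone on that diagram. -/
instance : (restrictedYoneda A κ).Full where
  map_surjective {X Y} f := by
    let hc := (isCardinalPresentable A κ).ι.denseAtEquiv X
      ((isCardinalPresentable A κ).ι.denseAt X)
    let φ {Z : presentableObjects A κ} (p : Z.obj ⟶ X) : Z.obj ⟶ Y := (f.hom.app (op Z)).hom p
    have hφ {Z W : presentableObjects A κ} (k : Z ⟶ W) (p : W.obj ⟶ X) :
        k.hom ≫ φ p = φ (k.hom ≫ p) :=
      congr(($(f.hom.naturality k.op)).hom p).symm
    let d : X ⟶ Y := hc.desc
      { pt := Y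
        ι := { app := fun p => φ p.hom
               naturality := fun p q k => by
                have h₁ : k.left.hom ≫ φ q.hom = φ p.hom :=
                  (hφ k.left q.hom).trans (congrArg φ (CostructuredArrow.w k))
                exact h₁.trans (Category.comp_id _).symm } }
    refine ⟨d, ObjectProperty.hom_ext _ (NatTrans.ext (funext fun Z => ?_))⟩
    ext (p : Z.unop.obj ⟶ X)
    have h : (𝟙 Z.unop.obj ≫ p) ≫ d = φ p := hc.fac _ (CostructuredArrow.mk p)
    rwa [Category.id_comp] at h

end

section

variable {A : Type u} [Category.{v} A] [Preadditive A] {κ : Cardinal.{v}} [Fact κ.IsRegular]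

instance essentiallySmall_presentableObjects [IsCardinalAccessibleCategory A κ] :
    EssentiallySmall.{v} (presentableObjects A κ) := by
  have : LocallySmall.{v} A := inferInstance
  infer_instance

instance isRightAdjoint_restrictedYoneda [IsCardinalLocallyPresentable A κ] :
    (restrictedYoneda A κ).IsRightAdjoint := by
  refine isRightAdjoint_of_leftAdjointObjIsDefined_yonedaMod _ fun X => ?_
  exact Functor.CorepresentableBy.isCorepresentable (X := X.obj)
    { homEquiv := ((Functor.FullyFaithful.ofFullyFaithful (restrictedYoneda A κ)).homEquiv).trans
        ((yonedaModIsoRestrictedYoneda A κ).app X).homFromEquiv.symm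
      homEquiv_comp := fun g f => by
        simp [Functor.FullyFaithful.homEquiv] }

variable [IsCardinalAccessibleCategory A κ] {Q : ModCat (presentableObjects A κ) ⥤ A}
  (adj : Q ⊣ restrictedYoneda A κ)

include adj in
theorem isIso_unit_app_yonedaMod (X : presentableObjects A κ) :
    IsIso (adj.unit.app ((yonedaMod _).obj X)) :=
  adj.isIso_unit_app_of_iso ((yonedaModIsoRestrictedYoneda A κ).app X)

/-- The left adjoint of the restricted Yoneda functor sends `Hom(-, X)` to `X`. -/
noncomputable def leftAdjointYonedaModIso (X : presentableObjects A κ) :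
    Q.obj ((yonedaMod _).obj X) ≅ X.obj :=
  Q.mapIso ((yonedaModIsoRestrictedYoneda A κ).app X) ≪≫ asIso (adj.counit.app X.obj)

include adj in
theorem isCardinalPresentable_leftAdjoint_yonedaMod (X : presentableObjects A κ) :
    IsCardinalPresentable (Q.obj ((yonedaMod _).obj X)) κ :=
  (isCardinalPresentable A κ).prop_of_iso (leftAdjointYonedaModIso adj X).symm X.property

include adj in
theorem isCardinalAccessible_restrictedYoneda : (restrictedYoneda A κ).IsCardinalAccessible κ := by
  refine adj.isCardinalAccessible_of_isStrongGenerator isStrongGenerator_smallRepresentables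
    (smallRepresentables_le κ) ?_
  rintro _ ⟨X⟩
  exact isCardinalPresentable_leftAdjoint_yonedaMod adj _

include adj in
theorem isCardinalPresentable_leftAdjoint_obj_of_restrictedYoneda
    (F : ModCat (presentableObjects A κ)) (hF : isCardinalPresentable _ κ F) :
    isCardinalPresentable A κ (Q.obj F) := by
  have := isCardinalAccessible_restrictedYoneda adj
  have : IsCardinalPresentable F κ := hF
  exact adj.isCardinalPresentable_leftAdjoint_obj κ F

/-- The restriction to presentable objects of the adjunction between a category and modules over
its presentable objects. -/
noncomputable def adjunctionYonedaModPresentable :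
    (isCardinalPresentable A κ).lift
      ((isCardinalPresentable (ModCat (presentableObjects A κ)) κ).ι ⋙ Q)
      (fun F => isCardinalPresentable_leftAdjoint_obj_of_restrictedYoneda adj F.obj F.property) ⊣
      yonedaModPresentable (presentableObjects A κ) κ :=
  adj.restrictFullyFaithful (ObjectProperty.fullyFaithfulι _) (ObjectProperty.fullyFaithfulι _)
    (Iso.refl _) (yonedaModIsoRestrictedYoneda A κ).symm

include adj in
-- `Q` preserves `κ`-presentability and so restricts to a left adjoint of `yonedaModPresentable`. By
-- uniqueness, any left adjoint occurring in `effCard` is this restriction.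
theorem effCard_iff (F : ModCat (presentableObjects A κ)) :
    effCard (presentableObjects A κ) κ F ↔ isCardinalPresentable _ κ F ∧ IsZero (Q.obj F) := by
  constructor
  · rintro ⟨hF, L, adjL, h⟩
    refine ⟨hF, ?_⟩
    have h' := h.of_iso ((adjunctionYonedaModPresentable adj).leftAdjointUniq adjL |>.app ⟨F, hF⟩)
    exact (isCardinalPresentable A κ).ι.map_isZero h'
  · rintro ⟨hF, h⟩
    exact ⟨hF, _, adjunctionYonedaModPresentable adj,
      IsZero.of_full_of_faithful_of_isZero (isCardinalPresentable A κ).ι _ h⟩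

end

/-! ### Exactness of `Q`, its kernel and the localisation. -/

section

variable {A : Type u} [Category.{v} A] [Abelian A] [IsGrothendieckAbelian.{v} A]
  {κ : Cardinal.{v}} [Fact κ.IsRegular] [IsCardinalLocallyPresentable A κ]
  {Q : ModCat (presentableObjects A κ) ⥤ A} (adj : Q ⊣ restrictedYoneda A κ)

include adj in
theorem preservesFiniteLimits_leftAdjoint_restrictedYoneda : PreservesFiniteLimits Q := by
  -- The exactness criterion is applied at `ℵ₀`, not at `κ`: representable modules are finitely
  -- presentable.
  have := Cardinal.fact_isRegular_aleph0.{v}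
  have := adj.left_adjoint_additive
  refine adj.preservesFiniteLimits_of_isStrongGenerator isStrongGenerator_smallRepresentables
    ?_ (smallRepresentables_le _)
  rintro _ ⟨X⟩
  exact isIso_unit_app_yonedaMod adj _

include adj in
theorem EffCard_iff (F : ModCat (presentableObjects A κ)) :
    EffCard (presentableObjects A κ) κ F ↔ IsZero (Q.obj F) := by
  have := adj.leftAdjoint_preservesColimits
  have := preservesFiniteLimits_leftAdjoint_restrictedYoneda adj
  have := isCardinalAccessible_restrictedYoneda adj
  constructor
  · rintro ⟨J, _, _, ⟨p⟩⟩
    rw [IsZero.iff_id_eq_zero]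
    refine (isColimitOfPreserves Q p.isColimit).hom_ext fun j => ?_
    exact ((effCard_iff adj _).1 (p.prop_diag_obj j)).2.eq_of_src _ _
  · intro hF
    refine exists_colimitsOfShape_of_factors (fun X hX => ((effCard_iff adj X).1 hX).1) F
      fun G hG g => ?_
    obtain ⟨X, hX, a, b, hab⟩ := adj.exists_factors_of_isZero (κ := κ) hF G g
    exact ⟨X, (effCard_iff adj X).2 hX, a, b, hab⟩

variable (A κ) in
theorem exists_isLocalization_EffCard :
    ∃ (Q : ModCat (presentableObjects A κ) ⥤ A) (_ : Q ⊣ restrictedYoneda A κ)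
      (_ : (EffCard (presentableObjects A κ) κ).IsSerreClass),
      PreservesFiniteLimits Q ∧ PreservesFiniteColimits Q ∧
      (∀ F, EffCard (presentableObjects A κ) κ F ↔ IsZero (Q.obj F)) ∧
      Q.IsLocalization (EffCard (presentableObjects A κ) κ).isoModSerre := by
  let Q := (restrictedYoneda A κ).leftAdjoint
  let adj : Q ⊣ restrictedYoneda A κ := Adjunction.ofIsRightAdjoint _
  have := adj.leftAdjoint_preservesColimits
  have := preservesFiniteLimits_leftAdjoint_restrictedYoneda adj
  have h : EffCard (presentableObjects A κ) κ = Q.kernel := by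
    ext F
    exact EffCard_iff adj F
  have hS : Q.kernel.IsSerreClass := inferInstanceAs (ObjectProperty.IsSerreClass (.inverseImage _ _))
  refine ⟨Q, adj, h ▸ hS, inferInstance, inferInstance, EffCard_iff adj, ?_⟩
  have := Abelian.isLocalization_isoModSerre_kernel_of_leftAdjoint adj
  convert this

end

/-! ### Abelianness of the categories of presentable objects. -/

section

variable (A : Type u) [Category.{v} A] [Abelian A] (κ : Cardinal.{v}) [Fact κ.IsRegular]

/-- The kernel computed in `A^κ` has the right universal property against `κ`-presentable objects.
These form a strong generator, so its comparison with the kernel in `A` is invertible. -/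
theorem isClosedUnderKernels_isCardinalPresentable_of_hasEqualizers
    [IsCardinalAccessibleCategory A κ] [HasEqualizers (presentableObjects A κ)] :
    (isCardinalPresentable A κ).IsClosedUnderKernels where
  kernels_le := by
    rintro _ ⟨f, k, hk, hX, hY⟩
    rename_i X Y
    let g : (⟨X, hX⟩ : presentableObjects A κ) ⟶ ⟨Y, hY⟩ := ObjectProperty.homMk f
    let K := kernel g
    have hK : (kernel.ι g).hom ≫ f = 0 := congrArg (·.hom) (kernel.condition g)
    let i : K.obj ⟶ kernel f := kernel.lift f (kernel.ι g).hom hK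
    have hi : i ≫ kernel.ι f = (kernel.ι g).hom := kernel.lift_ι _ _ _
    have hP := (isCardinalFilteredGenerator_isCardinalPresentable A κ).isStrongGenerator
    have : Mono i := by
      rw [hP.isSeparating.mono_iff]
      intro G hG a b hab
      have : (ObjectProperty.homMk a : (⟨G, hG⟩ : presentableObjects A κ) ⟶ K) =
          ObjectProperty.homMk b := by
        rw [← cancel_mono (kernel.ι g)]
        refine ObjectProperty.hom_ext _ ?_
        change a ≫ (kernel.ι g).hom = b ≫ (kernel.ι g).hom
        rw [← hi, reassoc_of% hab]
      exact congrArg (·.hom) this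
    have : IsIso i := by
      refine hP.isIso_of_mono i fun G hG b => ?_
      let b' : (⟨G, hG⟩ : presentableObjects A κ) ⟶ ⟨X, hX⟩ :=
        ObjectProperty.homMk (b ≫ kernel.ι f)
      have hb' : b' ≫ g = 0 := by
        refine ObjectProperty.hom_ext _ ?_
        change (b ≫ kernel.ι f) ≫ f = 0
        simp
      refine ⟨(kernel.lift g b' hb').hom, ?_⟩
      dsimp only
      rw [← cancel_mono (kernel.ι f), Category.assoc, hi]
      exact congrArg (·.hom) (kernel.lift_ι g b' hb')
    exact (isCardinalPresentable A κ).prop_of_iso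
      (asIso i ≪≫ (limit.isLimit _).conePointUniqueUpToIso hk) K.property

instance : (isCardinalPresentable A κ).ContainsZero := by
  have := isClosedUnderFiniteColimits_isCardinalPresentable (A := A) (β := κ)
    (J := Discrete PEmpty)
  infer_instance

instance : (isCardinalPresentable A κ).IsClosedUnderFiniteProducts := by
  have : (isCardinalPresentable A κ).IsClosedUnderBinaryProducts := ⟨fun X ⟨p⟩ =>
    (isCardinalPresentable A κ).prop_of_iso
      (biprod.isoProd _ _ ≪≫ HasLimit.isoOfNatIso (diagramIsoPair p.diag).symm ≪≫
        (limit.isLimit _).conePointUniqueUpToIso p.isLimit)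
      (isCardinalPresentable_biprod (p.prop_diag_obj _) (p.prop_diag_obj _))⟩
  exact ObjectProperty.IsClosedUnderFiniteProducts.mk'

variable {A κ}

theorem isAbelianCategory_presentableObjects_of_le [IsGrothendieckAbelian.{v} A]
    [IsCardinalLocallyPresentable A κ] (hκ : IsAbelianCategory (presentableObjects A κ))
    {β : Cardinal.{v}} [Fact β.IsRegular] (h : κ ≤ β) :
    IsAbelianCategory (presentableObjects A β) := by
  have : HasEqualizers (presentableObjects A κ) := by
    obtain ⟨_⟩ := hκ
    infer_instance
  have := isClosedUnderKernels_isCardinalPresentable_of_hasEqualizers A κ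
  have := isClosedUnderKernels_isCardinalPresentable_of_le h (A := A)
  exact ⟨inferInstance⟩

end

end CategoryTheory

theorem mainTheorem5 {A : Type u} [Category.{v} A] [Abelian A] [IsGrothendieckAbelian.{v} A]
    (κ : Cardinal.{v}) [Fact κ.IsRegular] [IsCardinalLocallyPresentable A κ]
    (hκ : IsAbelianCategory (presentableObjects A κ)) :
    (∃ (Q : ModCat (presentableObjects A κ) ⥤ A) (_ : Q ⊣ restrictedYoneda A κ)
      (_ : (EffCard (presentableObjects A κ) κ).IsSerreClass),
      PreservesFiniteLimits Q ∧ PreservesFiniteColimits Q ∧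
      (∀ F, EffCard (presentableObjects A κ) κ F ↔ IsZero (Q.obj F)) ∧
      Q.IsLocalization (EffCard (presentableObjects A κ) κ).isoModSerre) ∧
    ∀ (β : Cardinal.{v}) [Fact β.IsRegular], κ ≤ β →
      IsAbelianCategory (presentableObjects A β) := by
  exact ⟨exists_isLocalization_EffCard A κ, fun _ _ h =>
    isAbelianCategory_presentableObjects_of_le hκ h⟩
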